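/- Let $(M,g)$ be a smooth $n$-dimensional Riemannian manifold, $p\in M$, $(e_1,\dots,e_n)$ a $g$-orthonormal basis of $T_pM$, and $r>0$ such that $x\mapsto\exp_p(\sum_i x^ie_i)$ is a diffeomorphism from the ball $B_r\subset\mathbb R^n$ onto an open set $U_p\subset M$; use the resulting normal coordinates $x^1,\dots,x^n$ on $U_p$ and write $D^\gamma=\partial_{x^1}^{\gamma_1}\cdots\partial_{x^n}^{\gamma_n}$. Let $E\to M$ be a smooth real vector bundle of finite rank $k$ with a connection $\nabla$. Definitions. Let $e_1(\cdot,g),\dots,e_n(\cdot,g)$ be the frame of $TU_p$ obtained from $(e_i)$ by Levi-Civita parallel transport along the radial geodesics $t\mapsto\exp_p(t\mathbf x)$. The vielbeins of $g$ are the matrices $(a_i^l(\cdot,g))$ and $(b_l^j(\cdot,g))$ with $\partial_{x^i}=\sum_l a_i^l\,e_l$ and $e_l=\sum_j b_l^j\,\partial_{x^j}$. A function (or matrix of functions) is a geometric polynomial with respect to $g$ of Gilkey order $d$ if it is (entrywise) a real linear combination of finite products of functions $D^\beta a_i^l(\cdot,g)$ and $D^\beta b_l^j(\cdot,g)$ in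 each of which the lengths $|\beta|$ add up to $d$. A differential operator $P$ of order (at most) $m$ on sections of $E$ over $U_p$ reads $P(\sum_j\alpha_js_j)=\sum_{|\gamma|\le m}\sum_{i,j}(P_\gamma)_{ij}D^\gamma(\alpha_j)\,s_i$ in a frame $(s_j)$ obtained by $\nabla$-parallel transport of a basis of $E_p$ along the radial geodesics; $P$ is geometric of order $m$ with respect to $g$ if every coefficient $P_\gamma$, $|\gamma|\le m$, is a geometric polynomial with respect to $g$ of Gilkey order $m-|\gamma|$. For $0<\lambda<1$ let $\mathfrak f_\lambda:U_p\to U_p^\lambda\subset U_p$, $\exp_p(\mathbf x)\mapsto\exp_p(\lambda\mathbf x)$, let $g_\lambda=\lambda^{-2}\mathfrak f_\lambda^*g$ on $U_p$, and let $\mathfrak f_\lambda^\sharp P$ be the operator $\sigma\mapsto P(\sigma\circ\mathfrak f_\lambda^{-1})\circ\mathfrak f_\lambda$ on sections of $\mathfrak f_\lambda^*E$ over $U_p$. Statement. Let $P$ be a differential operator of order $m$ on $E$ over $U_p$ that is geometric with respect to $g$. Then, for every $0<\lambda<1$, $g_\lambda$ is a Riemannian metric on $U_p$, the coordinates $x^1,\dots,x^n$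 are also its normal coordinates at $p$ for the basis $(e_i)$, and $\mathfrak f_\lambda^\sharp P$ is a differential operator of order $m$ that is geometric with respect to $g_\lambda$, both as an operator on $\mathfrak f_\lambda^*E$ with the connection $\mathfrak f_\lambda^*\nabla$ and, after identifying $\mathfrak f_\lambda^*E$ with $E|_{U_p}$ by $\nabla$-parallel transport along the radial geodesics, as an operator on $(E,\nabla)$. The Gilkey orders of its coefficients are the same as those of $P$: write $P_\gamma$ for the coefficients of $P$ in a radially parallel frame $(s_j)$ and $P'_\gamma$ for those of $\mathfrak f_\lambda^\sharp P$ in the frame $(s_j\circ\mathfrak f_\lambda)$, which is radially parallel for $\mathfrak f_\lambda^*\nabla$. Then for all $|\gamma|\le m$ and all $d$, $P'_\gamma$ is a geometric polynomial with respect to $g_\lambda$ of Gilkey order $d$ on $U_p$ if and only if $P_\gamma$ is one with respect to $g$ of Gilkey order $d$ on $U_p^\lambda$; and $P'_\gamma$ vanishes at $x\in U_p$ if and only if $P_\gamma$ vanishes at $\mathfrak f_\lambda(x)$. -/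

import Mathlib

open Bundle
open scoped Manifold ContDiff

noncomputable section

namespace GeomOp

/-! ### Calculus in the coordinate space -/

/-- The coordinate space `ℝⁿ`. -/
abbrev Coord (n : ℕ) : Type := EuclideanSpace ℝ (Fin n)

/-- The partial derivative `∂f/∂xⁱ`. -/
def partialD {n : ℕ} (i : Fin n) (f : Coord n → ℝ) : Coord n → ℝ :=
  fun x => fderiv ℝ f x (EuclideanSpace.single i 1)

/-- The length `|γ|` of a multi-index. -/
def multiLength {n : ℕ} (γ : Fin n → ℕ) : ℕ := ∑ i, γ i

/-- `D^γ f = (∂/∂x¹)^{γ₁} ⋯ (∂/∂xⁿ)^{γₙ} f`. -/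
def multiD {n : ℕ} (γ : Fin n → ℕ) (f : Coord n → ℝ) : Coord n → ℝ :=
  (List.finRange n).foldr (fun i h => (partialD i)^[γ i] h) f

/-- The finite set of multi-indices with `|γ| ≤ m`. -/
def multiIndices (n m : ℕ) : Finset (Fin n → ℕ) :=
  (Finset.Iic (fun _ : Fin n => m)).filter (fun γ => multiLength γ ≤ m)

/-! ### Metrics, geodesics and parallel transport, read in a chart

`M` is a manifold modelled on `ℝⁿ`, and `X` is a chart `M ⊇ X.source → X.target ⊆ ℝⁿ`. -/

section Metric

variable {n : ℕ} {M : Type*} [TopologicalSpace M] [ChartedSpace (Coord n) M]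

/-- A field of bilinear forms on the tangent spaces. -/
abbrev BilinField (n : ℕ) (M : Type*) [TopologicalSpace M] [ChartedSpace (Coord n) M] : Type _ :=
  (y : M) → LinearMap.BilinForm ℝ (TangentSpace (𝓡 n) y)

/-- The field of bilinear forms underlying a smooth Riemannian metric on `M`. -/
def metricField [IsManifold (𝓡 n) ∞ M]
    (g : ContMDiffRiemannianMetric (𝓡 n) ∞ (Coord n) (TangentSpace (𝓡 n) : M → Type _)) :
    BilinField n M :=
  fun y => LinearMap.mk₂ ℝ (fun v w => g.inner y v w)
    (by intros; simp) (by intros; simp) (by intros; simp) (by intros; simp)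

/-- The components `(v¹, …, vⁿ)` of a tangent vector `v = ∑ vⁱ ∂/∂xⁱ` in the chart `X`. -/
def comps (X : OpenPartialHomeomorph M (Coord n)) (y : M) (v : TangentSpace (𝓡 n) y) : Coord n :=
  mfderiv (𝓡 n) 𝓘(ℝ, Coord n) X y v

/-- The coordinate vector `∂/∂xⁱ` at the point with coordinates `x`. -/
def coordVec (X : OpenPartialHomeomorph M (Coord n)) (x : Coord n) (i : Fin n) :
    TangentSpace (𝓡 n) (X.symm x) :=
  mfderiv 𝓘(ℝ, Coord n) (𝓡 n) X.symm x (EuclideanSpace.single i (1 : ℝ) : Coord n)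

/-- The matrix `(g_{ij}(x))` of the metric in the chart `X`. -/
def gram (g : BilinField n M) (X : OpenPartialHomeomorph M (Coord n)) (x : Coord n) :
    Matrix (Fin n) (Fin n) ℝ :=
  Matrix.of fun i j => g (X.symm x) (coordVec X x i) (coordVec X x j)

/-- `g` is a smooth Riemannian metric on the domain of the chart `X`. -/
structure IsRiemannianOn (g : BilinField n M) (X : OpenPartialHomeomorph M (Coord n)) : Prop where
  symm : ∀ y ∈ X.source, ∀ v w, g y v w = g y w v
  pos : ∀ y ∈ X.source, ∀ v, v ≠ 0 → 0 < g y v v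
  smooth : ∀ i j, ContDiffOn ℝ ∞ (fun x => gram g X x i j) X.target

/-- The Christoffel symbols `Γ^k_{ij}` of the Levi-Civita connection of `g` in the chart `X`. -/
def christoffel (g : BilinField n M) (X : OpenPartialHomeomorph M (Coord n)) (k i j : Fin n)
    (x : Coord n) : ℝ :=
  (1 / 2) * ∑ l, (gram g X x)⁻¹ k l *
    (partialD i (fun z => gram g X z j l) x + partialD j (fun z => gram g X z i l) x
      - partialD l (fun z => gram g X z i j) x)

/-- The velocity `c'(t)` of a curve. -/
def velocity (c : ℝ → M) (t : ℝ) : TangentSpace (𝓡 n) (c t) :=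
  mfderiv 𝓘(ℝ, ℝ) (𝓡 n) c t (1 : ℝ)

/-- The vector field `V` along the curve `c`, which runs in the domain of the chart `X`, is
parallel for the Levi-Civita connection of `g` at all times in the (open) set `S`:
`dV^k/dt + ∑ Γ^k_{ij}(c) (c')ⁱ V^j = 0`. -/
def IsParallelAlong (g : BilinField n M) (X : OpenPartialHomeomorph M (Coord n)) (c : ℝ → M)
    (V : (t : ℝ) → TangentSpace (𝓡 n) (c t)) (S : Set ℝ) : Prop :=
  ∀ t ∈ S, c t ∈ X.source ∧ ∀ k, HasDerivAt (fun τ => comps X (c τ) (V τ) k)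
    (-∑ i, ∑ j, christoffel g X k i j (X (c t)) *
      comps X (c t) (velocity c t) i * comps X (c t) (V t) j) t

/-- `c` is a geodesic of `g` on the (open) set `S` of times. -/
def IsGeodesicOn (g : BilinField n M) (X : OpenPartialHomeomorph M (Coord n)) (c : ℝ → M)
    (S : Set ℝ) : Prop :=
  ContMDiffOn 𝓘(ℝ, ℝ) (𝓡 n) ∞ c S ∧ IsParallelAlong g X c (fun t => velocity c t) S

/-- The curve with coordinates `t ↦ t x`; in normal coordinates it is `t ↦ exp_p(t ∑ xⁱ eᵢ)`. -/
def ray (X : OpenPartialHomeomorph M (Coord n)) (x : Coord n) : ℝ → M := fun t => X.symm (t • x)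

/-- The times at which the ray in the direction `x` stays in the chart. -/
def rayTimes (X : OpenPartialHomeomorph M (Coord n)) (x : Coord n) : Set ℝ := {t | t • x ∈ X.target}

/-- `X` is the system of normal geodesic coordinates of `g` at `p`, on the ball `B_r`, given by the
`g`-orthonormal basis `e` of `T_pM`: it is a chart of `M` onto the ball `B_r`, whose inverse is
`x ↦ exp_p(∑ xⁱ eᵢ)`, that is, the curve `t ↦ X⁻¹(t x)` is the geodesic that starts at `p` with
velocity `∑ xⁱ eᵢ`. -/
structure IsNormalChart (g : BilinField n M) (p : M) (e : Fin n → TangentSpace (𝓡 n) p) (r : ℝ)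
    (X : OpenPartialHomeomorph M (Coord n)) : Prop where
  radius_pos : 0 < r
  orthonormal : ∀ i j, g p (e i) (e j) = if i = j then 1 else 0
  mem_atlas : X ∈ IsManifold.maximalAtlas (𝓡 n) ∞ M
  target_eq : X.target = Metric.ball 0 r
  base_mem : p ∈ X.source
  base_eq : X p = 0
  initial_velocity : ∀ i, comps X p (e i) = EuclideanSpace.single i 1
  geodesic : ∀ x, IsGeodesicOn g X (ray X x) (rayTimes X x)

/-- `ε` is the frame `e₁(·, g), …, eₙ(·, g)` obtained by parallel transport of the basis `e` of
`T_pM` along the radial geodesics. -/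
structure IsTangentFrame (g : BilinField n M) (p : M) (e : Fin n → TangentSpace (𝓡 n) p)
    (X : OpenPartialHomeomorph M (Coord n)) (ε : Fin n → (y : M) → TangentSpace (𝓡 n) y) :
    Prop where
  base : ∀ l, ε l p = e l
  parallel : ∀ l x, IsParallelAlong g X (ray X x) (fun t => ε l (ray X x t)) (rayTimes X x)

/-- The vielbein `B = (b_l^j)`, row `l`, column `j`: `e_l = ∑_j b_l^j ∂/∂x^j`. -/
def vielbeinB (X : OpenPartialHomeomorph M (Coord n)) (ε : Fin n → (y : M) → TangentSpace (𝓡 n) y)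
    (x : Coord n) : Matrix (Fin n) (Fin n) ℝ :=
  Matrix.of fun l j => comps X (X.symm x) (ε l (X.symm x)) j

/-- The vielbein `A = B⁻¹ = (a_i^l)`, row `i`, column `l`: `∂/∂xⁱ = ∑_l a_i^l e_l`. -/
def vielbeinA (X : OpenPartialHomeomorph M (Coord n)) (ε : Fin n → (y : M) → TangentSpace (𝓡 n) y)
    (x : Coord n) : Matrix (Fin n) (Fin n) ℝ :=
  (vielbeinB X ε x)⁻¹

end Metric

/-! ### Geometric polynomials and their Gilkey order -/

/-- The symbols `D^β a_i^l` (left, `(i, l, β)`) and `D^β b_l^i` (right, `(l, i, β)`). -/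
abbrev JetVar (n : ℕ) : Type :=
  (Fin n × Fin n × (Fin n → ℕ)) ⊕ (Fin n × Fin n × (Fin n → ℕ))

/-- The weight `|β|` of the symbols `D^β a_i^l` and `D^β b_l^i`. -/
def jetWeight {n : ℕ} : JetVar n → ℕ
  | .inl v => multiLength v.2.2
  | .inr v => multiLength v.2.2

section Polynomials

variable {n : ℕ} {M : Type*} [TopologicalSpace M] [ChartedSpace (Coord n) M]

/-- The values at `x` of the jets of the vielbeins. -/
def jetValue (X : OpenPartialHomeomorph M (Coord n)) (ε : Fin n → (y : M) → TangentSpace (𝓡 n) y)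
    (x : Coord n) : JetVar n → ℝ
  | .inl v => multiD v.2.2 (fun z => vielbeinA X ε z v.1 v.2.1) x
  | .inr v => multiD v.2.2 (fun z => vielbeinB X ε z v.1 v.2.1) x

/-- On the set `W` of coordinates, the matrix-valued function `q` is a geometric polynomial of
Gilkey order `d`: each entry is a linear combination of products of jets of the vielbeins, each
product having total number of derivatives equal to `d`. -/
def IsGeometricPolynomial {k : ℕ} (X : OpenPartialHomeomorph M (Coord n))
    (ε : Fin n → (y : M) → TangentSpace (𝓡 n) y) (W : Set (Coord n))
    (q : Coord n → Matrix (Fin k) (Fin k) ℝ) (d : ℕ) : Prop :=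
  ∀ i j, ∃ Q : MvPolynomial (JetVar n) ℝ, MvPolynomial.IsWeightedHomogeneous jetWeight Q d ∧
    ∀ x ∈ W, q x i j = MvPolynomial.eval (jetValue X ε x) Q

end Polynomials

/-! ### Differential operators and geometric operators

Sections are arbitrary dependent functions; a local section is extended in any way outside its
domain, and smoothness is required where it matters. `V` is a family of vector spaces (a vector
bundle `E` or a pull-back of it), `smoothOn` says which of its sections are smooth on which sets,
and `cov σ y v` is the covariant derivative `(∇_v σ)(y)`. -/

section Operators

variable {n k : ℕ} {M : Type*} [TopologicalSpace M] [ChartedSpace (Coord n) M]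
  {V : M → Type*} [∀ y, AddCommGroup (V y)] [∀ y, Module ℝ (V y)]

/-- The section `σ` is parallel along all the curves `t ↦ X⁻¹(t x)`. -/
def IsRadiallyParallel (cov : ((y : M) → V y) → (y : M) → TangentSpace (𝓡 n) y → V y)
    (X : OpenPartialHomeomorph M (Coord n)) (σ : (y : M) → V y) : Prop :=
  ∀ x, ∀ t ∈ rayTimes X x, cov σ (ray X x t) (velocity (ray X x) t) = 0

/-- `s₁, …, s_k` is a smooth frame over the domain of `X` which is obtained by parallel transport of
a basis of the central fibre along the curves `t ↦ X⁻¹(t x)`. -/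
structure IsRadialFrame (smoothOn : ((y : M) → V y) → Set M → Prop)
    (cov : ((y : M) → V y) → (y : M) → TangentSpace (𝓡 n) y → V y)
    (X : OpenPartialHomeomorph M (Coord n)) (s : Fin k → (y : M) → V y) : Prop where
  smooth : ∀ j, smoothOn (s j) X.source
  linearIndependent : ∀ y ∈ X.source, LinearIndependent ℝ (fun j => s j y)
  span_eq_top : ∀ y ∈ X.source, Submodule.span ℝ (Set.range fun j => s j y) = ⊤
  parallel : ∀ j, IsRadiallyParallel cov X (s j)

/-- Over the domain of the chart `X`, the operator `P` is the differential operator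
`∑_{|γ| ≤ m} P_γ D^γ` with the smooth coefficients `P_γ = c γ`, written in the frame `s`:
`P (∑_j α_j s_j) = ∑_{|γ| ≤ m} ∑_{i,j} (P_γ)_{ij} D^γ(α_j) s_i`, for sections that are given on an
arbitrary open subset `W`. -/
structure HasCoeffs (X : OpenPartialHomeomorph M (Coord n)) (s : Fin k → (y : M) → V y) (m : ℕ)
    (c : (Fin n → ℕ) → Coord n → Matrix (Fin k) (Fin k) ℝ)
    (P : ((y : M) → V y) → (y : M) → V y) : Prop where
  smooth : ∀ γ ∈ multiIndices n m, ∀ i j, ContDiffOn ℝ ∞ (fun x => c γ x i j) X.target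
  apply_eq : ∀ W : Set M, IsOpen W → W ⊆ X.source →
    ∀ α : Fin k → M → ℝ, (∀ j, ContMDiffOn (𝓡 n) 𝓘(ℝ, ℝ) ∞ (α j) W) →
    ∀ σ : (y : M) → V y, (∀ z ∈ W, σ z = ∑ j, α j z • s j z) →
    ∀ y ∈ W, P σ y = ∑ γ ∈ multiIndices n m, ∑ i, ∑ j,
      (c γ (X y) i j * multiD γ (fun x => α j (X.symm x)) (X y)) • s i y

/-- `P` is, over the domain of the normal chart `X`, a differential operator of order `m` which is
geometric with respect to the metric `g`: in a frame obtained by radial parallel transport, each of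
its coefficients `P_γ` is a geometric polynomial of Gilkey order `m - |γ|`. -/
def IsGeometric (k : ℕ) (g : BilinField n M) (p : M) (e : Fin n → TangentSpace (𝓡 n) p) (r : ℝ)
    (X : OpenPartialHomeomorph M (Coord n)) (smoothOn : ((y : M) → V y) → Set M → Prop)
    (cov : ((y : M) → V y) → (y : M) → TangentSpace (𝓡 n) y → V y) (m : ℕ)
    (P : ((y : M) → V y) → (y : M) → V y) : Prop :=
  IsNormalChart g p e r X ∧
  ∃ (ε : Fin n → (y : M) → TangentSpace (𝓡 n) y) (s : Fin k → (y : M) → V y)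
    (c : (Fin n → ℕ) → Coord n → Matrix (Fin k) (Fin k) ℝ),
    IsTangentFrame g p e X ε ∧ IsRadialFrame smoothOn cov X s ∧ HasCoeffs X s m c P ∧
    ∀ γ ∈ multiIndices n m, IsGeometricPolynomial X ε X.target (c γ) (m - multiLength γ)

end Operators

/-! ### Contractions and pull-backs -/

section Contraction

variable {n : ℕ} {M : Type*} [TopologicalSpace M] [ChartedSpace (Coord n) M]

/-- The contraction `f_lam`: `exp_p(x) ↦ exp_p(lam x)`. The inverse of `f_lam` is given by the same
formula with `lam⁻¹`, on the image of `f_lam`. -/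
def contraction (X : OpenPartialHomeomorph M (Coord n)) (lam : ℝ) : M → M :=
  fun y => X.symm (lam • X y)

/-- The dilated metric `g_lam = lam⁻² f_lam^* g`. -/
def dilatedMetric (g : BilinField n M) (X : OpenPartialHomeomorph M (Coord n)) (lam : ℝ) :
    BilinField n M :=
  fun y => (lam ^ 2)⁻¹ • (g (contraction X lam y)).compl₁₂
    (mfderiv (𝓡 n) (𝓡 n) (contraction X lam) y).toLinearMap
    (mfderiv (𝓡 n) (𝓡 n) (contraction X lam) y).toLinearMap

variable {E : M → Type*} [∀ y, AddCommGroup (E y)]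

/-- For a section `σ` of `f^*E`, the section `(f^*)⁻¹ σ = σ ∘ f⁻¹` of `E` over the image of `f`,
where `h` is the inverse of `f`; it is extended by zero. -/
def pushSection (f h : M → M) (σ : (y : M) → E (f y)) : (z : M) → E z :=
  open Classical in fun z => if hz : f (h z) = z then hz ▸ σ (h z) else 0

/-- The operator `f^♯ P = f^* ∘ P ∘ (f^*)⁻¹` on sections of `f^*E`: `σ ↦ P(σ ∘ f⁻¹) ∘ f`. -/
def pullOperator (f h : M → M) (P : ((y : M) → E y) → (y : M) → E y) :
    ((y : M) → E (f y)) → (y : M) → E (f y) :=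
  fun σ y => P (pushSection f h σ) (f y)

variable [∀ y, Module ℝ (E y)]

/-- The operator on sections of `E` that corresponds to an operator `Q` on sections of `f^*E`
under an identification `Φ_y : (f^*E)_y = E_{f(y)} ≃ E_y` of the fibres. -/
def conjOperator {f : M → M} (Φ : (y : M) → E (f y) ≃ₗ[ℝ] E y)
    (Q : ((y : M) → E (f y)) → (y : M) → E (f y)) : ((y : M) → E y) → (y : M) → E y :=
  fun σ y => Φ y (Q (fun z => (Φ z).symm (σ z)) y)

variable (n) (F : Type*) [NormedAddCommGroup F] [NormedSpace ℝ F] [TopologicalSpace (TotalSpace F E)]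
  [∀ y, TopologicalSpace (E y)] [FiberBundle F E]

/-- Smoothness on `U` of a section of the pull-back bundle `f^*E`, as a map into the total space of
`E`. -/
def PullSmoothOn (f : M → M) (σ : (y : M) → E (f y)) (U : Set M) : Prop :=
  ContMDiffOn (𝓡 n) ((𝓡 n).prod 𝓘(ℝ, F)) ∞ (fun y => (⟨f y, σ y⟩ : TotalSpace F E)) U

/-- Smoothness on `U` of a section of `E`. -/
def SmoothOn (σ : (y : M) → E y) (U : Set M) : Prop :=
  ContMDiffOn (𝓡 n) ((𝓡 n).prod 𝓘(ℝ, F)) ∞ (fun y => (⟨y, σ y⟩ : TotalSpace F E)) U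

variable {n F}
variable [∀ y, IsTopologicalAddGroup (E y)] [∀ y, ContinuousSMul ℝ (E y)]

/-- The connection `∇` as a map `σ ↦ (y, v) ↦ (∇_v σ)(y)`. -/
def connection (nabla : CovariantDerivative (𝓡 n) F E) (σ : (y : M) → E y) (y : M)
    (v : TangentSpace (𝓡 n) y) : E y :=
  nabla σ y v

/-- The pull-back connection on `f^*E` by a diffeomorphism `f` onto an open set, with inverse `h`:
`(f^*∇)_v (τ ∘ f) = (∇_{df(v)} τ) ∘ f`. -/
def pullConnection (nabla : CovariantDerivative (𝓡 n) F E) (f h : M → M) (σ : (y : M) → E (f y))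
    (y : M) (v : TangentSpace (𝓡 n) y) : E (f y) :=
  nabla (pushSection f h σ) (f y) (mfderiv (𝓡 n) (𝓡 n) f y v)

/-- `Φ_y : E_{f(y)} → E_y` is, over the domain of `X`, the parallel transport from `f(y)` to `y`
along the radial curve through `y`: it maps `σ(f(y))` to `σ(y)` for each radially parallel section
`σ`. -/
def IsRadialTransport (nabla : CovariantDerivative (𝓡 n) F E)
    (X : OpenPartialHomeomorph M (Coord n)) (f : M → M) (Φ : (y : M) → E (f y) ≃ₗ[ℝ] E y) : Prop :=
  ∀ σ : (y : M) → E y, SmoothOn n F σ X.source → IsRadiallyParallel (connection nabla) X σ →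
    ∀ y ∈ X.source, Φ y (σ (f y)) = σ y

end Contraction

end GeomOp

end

open GeomOp

namespace GeomOp

open Filter Topology

/-! ### Partial derivatives and weighted homogeneous polynomials under a dilation -/

section Calculus

variable {n : ℕ}

/-! In normal coordinates the contraction is the linear map `x ↦ λx`, and the statement becomes
bookkeeping of powers of `λ`. The differential of the contraction contributes two factors `λ` to the
pulled-back metric, which the normalisation `λ⁻²` cancels, so the Gram matrix of `g_λ` at `x` is
that of `g` at `λx` (`gram_dilatedMetric`). Its Christoffel symbols are therefore `λ Γ(λx)`. With
this factor the rays from the origin remain geodesics, and the frame with the components of `ε` at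
`λx` is radially parallel for `g_λ`; hence the vielbeins of `g_λ` are those of `g` composed with `x
↦ λx`.

By the chain rule a jet `D^β` of a vielbein gains `λ^|β|`, so a polynomial of Gilkey order `d` gains
`λ^d` (`eval_smul_of_isWeightedHomogeneous`). On the operator side, differentiating `α ∘ f_λ⁻¹`
gives `P'_γ(x) = λ^(-|γ|) P_γ(λx)` (`hasCoeffs_pullOperator`). Both factors are nonzero constants
and can be absorbed into the polynomial, which gives the equivalence for each `d`
(`isGeometricPolynomial_dilatedFrame_iff`). The bundle enters only through its radial frame: the
contraction maps rays to rays, so `s_j ∘ f_λ` is again radially parallel (`isRadialFrame_pullBack`).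
-/

theorem partialD_congr {i : Fin n} {f h : Coord n → ℝ} {x : Coord n} (H : f =ᶠ[𝓝 x] h) :
    partialD i f =ᶠ[𝓝 x] partialD i h :=
  (H.fderiv (𝕜 := ℝ)).mono fun y hy => by simp only [partialD, hy]

theorem partialD_iterate_congr {i : Fin n} {f h : Coord n → ℝ} {x : Coord n}
    (H : f =ᶠ[𝓝 x] h) (k : ℕ) : (partialD i)^[k] f =ᶠ[𝓝 x] (partialD i)^[k] h := by
  induction k with
  | zero => exact H
  | succ k ih =>
    simp only [Function.iterate_succ_apply']
    exact partialD_congr ih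

theorem multiD_congr (γ : Fin n → ℕ) {f h : Coord n → ℝ} {x : Coord n} (H : f =ᶠ[𝓝 x] h) :
    multiD γ f =ᶠ[𝓝 x] multiD γ h := by
  unfold multiD
  induction List.finRange n with
  | nil => exact H
  | cons i l ih => exact partialD_iterate_congr ih (γ i)

theorem partialD_const_mul (i : Fin n) (a : ℝ) (f : Coord n → ℝ) :
    partialD i (fun x => a * f x) = fun x => a * partialD i f x := by
  funext x
  simp only [partialD]
  rw [show (fun x => a * f x) = a • f from rfl, fderiv_const_smul_field]
  rfl

theorem partialD_comp_smul (i : Fin n) (a : ℝ) (f : Coord n → ℝ) :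
    partialD i (fun x => f (a • x)) = fun x => a * partialD i f (a • x) := by
  funext x
  simp only [partialD]
  rw [fderiv_comp_smul]
  rfl

/-- The prefactor `b` collects the powers of `a` produced by the other variables when the iterated
derivatives are composed in `multiD`. -/
theorem partialD_iterate_comp_smul (i : Fin n) (a b : ℝ) (f : Coord n → ℝ) (k : ℕ) :
    (partialD i)^[k] (fun x => b * f (a • x)) =
      fun x => a ^ k * b * (partialD i)^[k] f (a • x) := by
  induction k with
  | zero => simp
  | succ k ih =>
    simp only [Function.iterate_succ_apply', ih]
    rw [partialD_const_mul, partialD_comp_smul]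
    funext x
    ring

/-- The chain rule for a dilation. No differentiability of `f` is needed. -/
theorem multiD_comp_smul (γ : Fin n → ℕ) (a : ℝ) (f : Coord n → ℝ) (x : Coord n) :
    multiD γ (fun x => f (a • x)) x = a ^ multiLength γ * multiD γ f (a • x) := by
  have key : ∀ l : List (Fin n),
      l.foldr (fun i h => (partialD i)^[γ i] h) (fun x => f (a • x)) =
        fun x => a ^ (l.map γ).sum * l.foldr (fun i h => (partialD i)^[γ i] h) f (a • x) := by
    intro l
    induction l with
    | nil => simp
    | cons i l ih =>
      simp only [List.foldr_cons, ih, partialD_iterate_comp_smul, List.map_cons, List.sum_cons,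
        pow_add]
  rw [multiD, key, multiLength, multiD, ← List.sum_ofFn, List.ofFn_eq_map]

/-- Every monomial `δ` of `Q` satisfies `∑ w i * δ i = d`, so each picks up the same factor `a ^ d`.
-/
theorem eval_smul_of_isWeightedHomogeneous {σ : Type*} {w : σ → ℕ} {Q : MvPolynomial σ ℝ} {d : ℕ}
    (hQ : MvPolynomial.IsWeightedHomogeneous w Q d) (a : ℝ) (u : σ → ℝ) :
    MvPolynomial.eval (fun v => a ^ w v * u v) Q = a ^ d * MvPolynomial.eval u Q := by
  rw [MvPolynomial.eval_eq, MvPolynomial.eval_eq, Finset.mul_sum]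
  refine Finset.sum_congr rfl fun δ hδ => ?_
  have hw : ∑ i ∈ δ.support, w i * δ i = d := by
    rw [← hQ (MvPolynomial.mem_support_iff.mp hδ), Finsupp.weight_apply, Finsupp.sum]
    exact Finset.sum_congr rfl fun i _ => mul_comm _ _
  simp only [mul_pow, Finset.prod_mul_distrib, ← pow_mul, Finset.prod_pow_eq_pow_sum, hw]
  ring

end Calculus

/-! ### Rays in the coordinate ball -/

section Rays

variable {n : ℕ} {M : Type*} [TopologicalSpace M] {X : OpenPartialHomeomorph M (Coord n)}

theorem isOpen_rayTimes (X : OpenPartialHomeomorph M (Coord n)) (x : Coord n) :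
    IsOpen (rayTimes X x) :=
  X.open_target.preimage (by fun_prop : Continuous fun t : ℝ => t • x)

theorem smul_mem_target {r : ℝ} (hr : X.target = Metric.ball 0 r) {a : ℝ} (ha : |a| ≤ 1)
    {x : Coord n} (hx : x ∈ X.target) : a • x ∈ X.target := by
  rw [hr, mem_ball_zero_iff] at *
  rw [norm_smul, Real.norm_eq_abs]
  nlinarith [norm_nonneg x]

end Rays

/-! ### Tangent vectors, rays and the contraction in a chart -/

section Chart

variable {n : ℕ} {M : Type*} [TopologicalSpace M] [ChartedSpace (Coord n) M]
  {X : OpenPartialHomeomorph M (Coord n)}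

theorem mdifferentiableAt_chart (hX : X ∈ IsManifold.maximalAtlas (𝓡 n) ∞ M) {y : M}
    (hy : y ∈ X.source) : MDifferentiableAt (𝓡 n) 𝓘(ℝ, Coord n) X y :=
  (contMDiffAt_of_mem_maximalAtlas hX hy).mdifferentiableAt (by simp)

theorem mdifferentiableAt_chart_symm (hX : X ∈ IsManifold.maximalAtlas (𝓡 n) ∞ M) {x : Coord n}
    (hx : x ∈ X.target) : MDifferentiableAt 𝓘(ℝ, Coord n) (𝓡 n) X.symm x :=
  (contMDiffAt_symm_of_mem_maximalAtlas hX hx).mdifferentiableAt (by simp)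

/-- The tangent vector at the point with coordinates `x` whose components are `u`. -/
noncomputable def vecAt (X : OpenPartialHomeomorph M (Coord n)) (x u : Coord n) :
    TangentSpace (𝓡 n) (X.symm x) :=
  mfderiv 𝓘(ℝ, Coord n) (𝓡 n) X.symm x u

theorem comps_vecAt (hX : X ∈ IsManifold.maximalAtlas (𝓡 n) ∞ M) {x : Coord n}
    (hx : x ∈ X.target) (u : Coord n) : comps X (X.symm x) (vecAt X x u) = u := by
  have h1 := mdifferentiableAt_chart hX (X.map_target hx)
  have h2 := mdifferentiableAt_chart_symm hX hx
  have h3 := mfderiv_comp x h1 h2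
  have h4 : (X ∘ X.symm) =ᶠ[𝓝 x] id := by
    filter_upwards [X.open_target.mem_nhds hx] with z hz using X.right_inv hz
  rw [h4.mfderiv_eq, mfderiv_id] at h3
  exact (congrArg (fun L => L u) h3).symm

/-- The two sides live over `X.symm (X y)` and `y`, which agree only propositionally; the ascription
to `Coord n`, the common model of all tangent spaces, makes them comparable. -/
theorem vecAt_comps (hX : X ∈ IsManifold.maximalAtlas (𝓡 n) ∞ M) {y : M}
    (hy : y ∈ X.source) (v : TangentSpace (𝓡 n) y) :
    (vecAt X (X y) (comps X y v) : Coord n) = v := by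
  have h1 := mdifferentiableAt_chart hX hy
  have h2 := mdifferentiableAt_chart_symm hX (X.map_source hy)
  have h3 := mfderiv_comp y h2 h1
  have h4 : (X.symm ∘ X) =ᶠ[𝓝 y] id := by
    filter_upwards [X.open_source.mem_nhds hy] with z hz using X.left_inv hz
  rw [h4.mfderiv_eq, mfderiv_id] at h3
  exact (congrArg (fun L => L v) h3).symm

theorem vecAt_smul (x u : Coord n) (a : ℝ) : vecAt X x (a • u) = a • vecAt X x u :=
  map_smul (mfderiv 𝓘(ℝ, Coord n) (𝓡 n) X.symm x) a u

theorem velocity_ray (hX : X ∈ IsManifold.maximalAtlas (𝓡 n) ∞ M) {x : Coord n} {t : ℝ}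
    (ht : t ∈ rayTimes X x) : velocity (ray X x) t = vecAt X (t • x) x := by
  have h1 : HasMFDerivAt 𝓘(ℝ, ℝ) 𝓘(ℝ, Coord n) (fun t : ℝ => t • x) t
      ((1 : ℝ →L[ℝ] ℝ).smulRight x) :=
    ((hasFDerivAt_id t).smul_const x).hasMFDerivAt
  have h3 := ((mdifferentiableAt_chart_symm hX ht).hasMFDerivAt).comp t h1
  have h4 : mfderiv 𝓘(ℝ, ℝ) (𝓡 n) (ray X x) t = _ := h3.mfderiv
  unfold velocity
  rw [h4]
  change mfderiv 𝓘(ℝ, Coord n) (𝓡 n) X.symm (t • x) ((1 : ℝ) • x) = _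
  rw [one_smul]
  rfl

theorem comps_velocity_ray (hX : X ∈ IsManifold.maximalAtlas (𝓡 n) ∞ M) {x : Coord n} {t : ℝ}
    (ht : t ∈ rayTimes X x) : comps X (ray X x t) (velocity (ray X x) t) = x := by
  rw [velocity_ray hX ht]
  exact comps_vecAt hX ht x

theorem mfderiv_contraction (hX : X ∈ IsManifold.maximalAtlas (𝓡 n) ∞ M) {a : ℝ} {y : M}
    (hy : y ∈ X.source) (hay : a • X y ∈ X.target) (v : TangentSpace (𝓡 n) y) :
    mfderiv (𝓡 n) (𝓡 n) (contraction X a) y v = a • vecAt X (a • X y) (comps X y v) := by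
  have h0 := (mdifferentiableAt_chart hX hy).hasMFDerivAt
  have h1 : HasMFDerivAt 𝓘(ℝ, Coord n) 𝓘(ℝ, Coord n) (fun x : Coord n => a • x) (X y)
      (a • ContinuousLinearMap.id ℝ (Coord n)) :=
    ((hasFDerivAt_id (X y)).const_smul a).hasMFDerivAt
  have h2 := (mdifferentiableAt_chart_symm hX hay).hasMFDerivAt
  have h3 := h2.comp y (h1.comp y h0)
  have h4 : mfderiv (𝓡 n) (𝓡 n) (contraction X a) y = _ := h3.mfderiv
  rw [h4]
  exact vecAt_smul (a • X y) (comps X y v) a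

end Chart

/-! ### The dilated metric, its geodesics, frames and vielbeins -/

section Dilation

variable {n : ℕ} {M : Type*} [TopologicalSpace M] [ChartedSpace (Coord n) M]
  {X : OpenPartialHomeomorph M (Coord n)} {g : BilinField n M} {a : ℝ}

theorem dilatedMetric_apply (hX : X ∈ IsManifold.maximalAtlas (𝓡 n) ∞ M) (ha : a ≠ 0) {y : M}
    (hy : y ∈ X.source) (hay : a • X y ∈ X.target) (v w : TangentSpace (𝓡 n) y) :
    dilatedMetric g X a y v w = g (X.symm (a • X y)) (vecAt X (a • X y) (comps X y v))
      (vecAt X (a • X y) (comps X y w)) := by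
  have h : dilatedMetric g X a y v w = (a ^ 2)⁻¹ * g (contraction X a y)
      (mfderiv (𝓡 n) (𝓡 n) (contraction X a) y v)
      (mfderiv (𝓡 n) (𝓡 n) (contraction X a) y w) := rfl
  rw [h, mfderiv_contraction hX hy hay, mfderiv_contraction hX hy hay]
  change (a ^ 2)⁻¹ * g (X.symm (a • X y)) (a • vecAt X (a • X y) (comps X y v))
    (a • vecAt X (a • X y) (comps X y w)) = _
  simp only [map_smul, LinearMap.smul_apply, smul_eq_mul]
  field_simp

theorem gram_dilatedMetric (hX : X ∈ IsManifold.maximalAtlas (𝓡 n) ∞ M) (ha : a ≠ 0)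
    {x : Coord n} (hx : x ∈ X.target) (hax : a • x ∈ X.target) :
    gram (dilatedMetric g X a) X x = gram g X (a • x) := by
  ext i j
  have hXx := X.right_inv hx
  change dilatedMetric g X a (X.symm x) (vecAt X x _) (vecAt X x _) = _
  rw [dilatedMetric_apply hX ha (X.map_target hx) (by rwa [hXx]), comps_vecAt hX hx,
    comps_vecAt hX hx, hXx]
  rfl

/-- The symbols contain exactly one derivative of the Gram matrix, hence one factor `a`; the inverse
Gram matrix is merely evaluated at `a • x`. -/
theorem christoffel_dilatedMetric (hX : X ∈ IsManifold.maximalAtlas (𝓡 n) ∞ M) (ha : a ≠ 0)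
    (hT : ∀ x ∈ X.target, a • x ∈ X.target) (k i j : Fin n) {x : Coord n} (hx : x ∈ X.target) :
    christoffel (dilatedMetric g X a) X k i j x = a * christoffel g X k i j (a • x) := by
  have key : ∀ i j l, partialD l (fun z => gram (dilatedMetric g X a) X z i j) x =
      a * partialD l (fun z => gram g X z i j) (a • x) := by
    intro i j l
    rw [← congrFun (partialD_comp_smul l a fun z => gram g X z i j) x]
    refine (partialD_congr ?_).eq_of_nhds
    filter_upwards [X.open_target.mem_nhds hx] with z hz
    rw [gram_dilatedMetric hX ha hz (hT z hz)]
  simp only [christoffel, key, gram_dilatedMetric hX ha hx (hT x hx)]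
  rw [mul_left_comm, Finset.mul_sum (a := a)]
  refine congrArg ((1 / 2 : ℝ) * ·) (Finset.sum_congr rfl fun l _ => ?_)
  ring

theorem isParallelAlong_ray_iff (hX : X ∈ IsManifold.maximalAtlas (𝓡 n) ∞ M) {x : Coord n}
    {V : (y : M) → TangentSpace (𝓡 n) y} :
    IsParallelAlong g X (ray X x) (fun t => V (ray X x t)) (rayTimes X x) ↔
      ∀ t : ℝ, t • x ∈ X.target → ∀ k, HasDerivAt
        (fun τ : ℝ => comps X (X.symm (τ • x)) (V (X.symm (τ • x))) k)
        (-∑ i, ∑ j, christoffel g X k i j (t • x) * x i *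
          comps X (X.symm (t • x)) (V (X.symm (t • x))) j) t := by
  refine forall₂_congr fun t ht => ?_
  have h1 : ray X x t ∈ X.source := X.map_target ht
  have h2 : X (ray X x t) = t • x := X.right_inv ht
  simp only [h1, true_and, comps_velocity_ray hX ht, h2]
  rfl

/-- The velocity of a ray has constant components `x`, so the geodesic equation loses its derivative
term and becomes an algebraic identity, which is easy to rescale. -/
theorem isParallelAlong_velocity_ray_iff (hX : X ∈ IsManifold.maximalAtlas (𝓡 n) ∞ M)
    {x : Coord n} :
    IsParallelAlong g X (ray X x) (fun t => velocity (ray X x) t) (rayTimes X x) ↔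
      ∀ t : ℝ, t • x ∈ X.target → ∀ k, ∑ i, ∑ j, christoffel g X k i j (t • x) * x i * x j = 0 := by
  refine forall₂_congr fun t ht => ?_
  have h1 : ray X x t ∈ X.source := X.map_target ht
  have h2 : X (ray X x t) = t • x := X.right_inv ht
  simp only [h1, true_and, comps_velocity_ray hX ht, h2]
  refine forall_congr' fun k => ?_
  have h3 : (fun τ => comps X (ray X x τ) (velocity (ray X x) τ) k) =ᶠ[𝓝 t] fun _ => x k := by
    filter_upwards [(isOpen_rayTimes X x).mem_nhds ht] with τ hτ
    rw [comps_velocity_ray hX hτ]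
  rw [h3.hasDerivAt_iff]
  constructor
  · intro h
    exact neg_eq_zero.mp (h.unique (hasDerivAt_const t (x k)))
  · intro h
    rw [h, neg_zero]
    exact hasDerivAt_const t (x k)

/-- The frame whose components at the point with coordinates `x` are those of `ε` at `a x`. -/
noncomputable def dilatedFrame (X : OpenPartialHomeomorph M (Coord n)) (a : ℝ)
    (ε : Fin n → (y : M) → TangentSpace (𝓡 n) y) (l : Fin n) (y : M) : TangentSpace (𝓡 n) y :=
  (vecAt X (X y) (comps X (contraction X a y) (ε l (contraction X a y))) : Coord n)

theorem comps_dilatedFrame (hX : X ∈ IsManifold.maximalAtlas (𝓡 n) ∞ M)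
    (ε : Fin n → (y : M) → TangentSpace (𝓡 n) y) (l : Fin n) {x : Coord n} (hx : x ∈ X.target) :
    comps X (X.symm x) (dilatedFrame X a ε l (X.symm x)) =
      comps X (X.symm (a • x)) (ε l (X.symm (a • x))) := by
  have h := comps_vecAt hX hx
    (comps X (contraction X a (X.symm x)) (ε l (contraction X a (X.symm x))))
  have h2 : contraction X a (X.symm x) = X.symm (a • x) := by
    rw [contraction, X.right_inv hx]
  rw [← h2]
  refine Eq.trans ?_ h
  unfold dilatedFrame
  rw [X.right_inv hx]

theorem vielbeinB_dilatedFrame (hX : X ∈ IsManifold.maximalAtlas (𝓡 n) ∞ M)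
    (ε : Fin n → (y : M) → TangentSpace (𝓡 n) y) {x : Coord n} (hx : x ∈ X.target) :
    vielbeinB X (dilatedFrame X a ε) x = vielbeinB X ε (a • x) := by
  ext l j
  simp only [vielbeinB, Matrix.of_apply, comps_dilatedFrame hX ε l hx]

/-- Both vielbeins are composed with the dilation near `x`, `A` because it is the pointwise inverse
of `B`; the chain rule then gives one factor `a` per derivative. -/
theorem jetValue_dilatedFrame (hX : X ∈ IsManifold.maximalAtlas (𝓡 n) ∞ M)
    (ε : Fin n → (y : M) → TangentSpace (𝓡 n) y) {x : Coord n} (hx : x ∈ X.target) :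
    jetValue X (dilatedFrame X a ε) x = fun v => a ^ jetWeight v * jetValue X ε (a • x) v := by
  have hT := X.open_target.mem_nhds hx
  funext v
  rcases v with ⟨i, l, β⟩ | ⟨l, i, β⟩
  · refine Eq.trans ?_ (multiD_comp_smul β a (fun z => vielbeinA X ε z i l) x)
    refine (multiD_congr β ?_).eq_of_nhds
    filter_upwards [hT] with z hz
    simp only [vielbeinA, vielbeinB_dilatedFrame hX ε hz]
  · refine Eq.trans ?_ (multiD_comp_smul β a (fun z => vielbeinB X ε z l i) x)
    refine (multiD_congr β ?_).eq_of_nhds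
    filter_upwards [hT] with z hz
    simp only [vielbeinB_dilatedFrame hX ε hz]

theorem isGeometricPolynomial_dilatedFrame_iff (hX : X ∈ IsManifold.maximalAtlas (𝓡 n) ∞ M)
    (ha : a ≠ 0) {b : ℝ} (hb : b ≠ 0) (ε : Fin n → (y : M) → TangentSpace (𝓡 n) y) {k : ℕ}
    (q : Coord n → Matrix (Fin k) (Fin k) ℝ) (d : ℕ) :
    IsGeometricPolynomial X (dilatedFrame X a ε) X.target (fun x => b • q (a • x)) d ↔
      IsGeometricPolynomial X ε ((fun x => a • x) '' X.target) q d := by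
  refine forall₂_congr fun i j => ⟨?_, ?_⟩
  · rintro ⟨Q, hQ, h⟩
    -- The constant undoes `b` and restores the factor `a ^ d` gained by the jets; the converse uses
    -- its inverse.
    refine ⟨MvPolynomial.C (b⁻¹ * a ^ d) * Q, hQ.C_mul _, ?_⟩
    rintro _ ⟨x, hx, rfl⟩
    have h1 := h x hx
    rw [jetValue_dilatedFrame hX ε hx, eval_smul_of_isWeightedHomogeneous hQ] at h1
    change b * q (a • x) i j = _ at h1
    change q (a • x) i j = MvPolynomial.eval (jetValue X ε (a • x)) _
    rw [map_mul, MvPolynomial.eval_C, mul_assoc, ← h1]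
    field_simp
  · rintro ⟨Q, hQ, h⟩
    refine ⟨MvPolynomial.C (b * (a ^ d)⁻¹) * Q, hQ.C_mul _, fun x hx => ?_⟩
    have h1 := h (a • x) ⟨x, hx, rfl⟩
    change b * q (a • x) i j = _
    rw [jetValue_dilatedFrame hX ε hx, map_mul, MvPolynomial.eval_C,
      eval_smul_of_isWeightedHomogeneous hQ, h1]
    field_simp

theorem isTangentFrame_dilatedFrame (hX : X ∈ IsManifold.maximalAtlas (𝓡 n) ∞ M) (ha : a ≠ 0)
    (hT : ∀ x ∈ X.target, a • x ∈ X.target) {p : M} (hp : p ∈ X.source) (hp0 : X p = 0)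
    {e : Fin n → TangentSpace (𝓡 n) p} {ε : Fin n → (y : M) → TangentSpace (𝓡 n) y}
    (hε : IsTangentFrame g p e X ε) :
    IsTangentFrame (dilatedMetric g X a) p e X (dilatedFrame X a ε) where
  base l := by
    have h1 : contraction X a p = p := by
      rw [contraction, hp0, smul_zero, ← hp0, X.left_inv hp]
    have h2 := vecAt_comps hX hp (ε l p)
    rw [← hε.base l]
    refine Eq.trans ?_ h2
    unfold dilatedFrame
    rw [h1]
  parallel l x := by
    rw [isParallelAlong_ray_iff hX]
    intro t ht k
    -- The transport equation for `ε` is used along the ray in direction `a • x` at the same time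
    -- `t`: the factor `a` in that direction matches the one in the new Christoffel symbols.
    have hat : t • (a • x) ∈ X.target := by rw [smul_comm]; exact hT _ ht
    have h1 := (isParallelAlong_ray_iff hX).mp (hε.parallel l (a • x)) t hat k
    have h2 : (fun τ : ℝ => comps X (X.symm (τ • x)) (dilatedFrame X a ε l (X.symm (τ • x))) k)
        =ᶠ[𝓝 t] fun τ => comps X (X.symm (τ • (a • x))) (ε l (X.symm (τ • (a • x)))) k := by
      filter_upwards [(isOpen_rayTimes X x).mem_nhds ht] with τ hτ
      rw [comps_dilatedFrame hX ε l hτ, smul_comm a τ x]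
    rw [h2.hasDerivAt_iff]
    refine h1.congr_deriv (congrArg Neg.neg (Finset.sum_congr rfl fun i _ => Finset.sum_congr rfl fun j _ => ?_))
    rw [christoffel_dilatedMetric hX ha hT k i j ht, comps_dilatedFrame hX ε l ht,
      smul_comm t a x, PiLp.smul_apply, smul_eq_mul]
    ring

theorem isNormalChart_dilatedMetric {r : ℝ} {p : M} {e : Fin n → TangentSpace (𝓡 n) p}
    (h : IsNormalChart g p e r X) (ha : a ≠ 0) (hT : ∀ x ∈ X.target, a • x ∈ X.target) :
    IsNormalChart (dilatedMetric g X a) p e r X where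
  radius_pos := h.radius_pos
  orthonormal i j := by
    have hX := h.mem_atlas
    have h0 : a • X p = X p := by rw [h.base_eq, smul_zero]
    rw [dilatedMetric_apply hX ha h.base_mem (by rw [h0]; exact X.map_source h.base_mem),
      ← h.orthonormal i j, h0]
    have h1 := vecAt_comps hX h.base_mem (e i)
    have h2 := vecAt_comps hX h.base_mem (e j)
    -- Generalising the base point allows `X.symm (X p) = p` to be substituted while the vectors
    -- stay fixed in `Coord n`.
    have h3 : ∀ q, q = p → ∀ v w : Coord n, (g q (v : TangentSpace (𝓡 n) q) w : ℝ) =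
        g p (v : TangentSpace (𝓡 n) p) w := by
      rintro _ rfl _ _; rfl
    refine (h3 _ (X.left_inv h.base_mem) _ _).trans ?_
    rw [h1, h2]
  mem_atlas := h.mem_atlas
  target_eq := h.target_eq
  base_mem := h.base_mem
  base_eq := h.base_eq
  initial_velocity := h.initial_velocity
  geodesic x := by
    refine ⟨(h.geodesic x).1, ?_⟩
    rw [isParallelAlong_velocity_ray_iff h.mem_atlas]
    intro t ht k
    -- Here the direction is kept and the time is rescaled: the identity at time `a * t`, multiplied
    -- by `a`, is the one required.
    have hat : (a * t) • x ∈ X.target := by rw [mul_smul]; exact hT _ ht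
    have h1 := (isParallelAlong_velocity_ray_iff h.mem_atlas).mp (h.geodesic x).2 (a * t) hat k
    simp only [christoffel_dilatedMetric h.mem_atlas ha hT k _ _ ht, smul_smul, mul_assoc,
      ← Finset.mul_sum]
    simp only [mul_assoc, mul_smul] at h1
    simp only [mul_smul, h1, mul_zero]

theorem isRiemannianOn_dilatedMetric (hX : X ∈ IsManifold.maximalAtlas (𝓡 n) ∞ M) (ha : a ≠ 0)
    (hT : ∀ x ∈ X.target, a • x ∈ X.target) (hg : IsRiemannianOn g X) :
    IsRiemannianOn (dilatedMetric g X a) X where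
  symm y hy v w := by
    have hay := hT _ (X.map_source hy)
    rw [dilatedMetric_apply hX ha hy hay, dilatedMetric_apply hX ha hy hay,
      hg.symm _ (X.map_target hay)]
  pos y hy v hv := by
    have hay := hT _ (X.map_source hy)
    rw [dilatedMetric_apply hX ha hy hay]
    refine hg.pos _ (X.map_target hay) _ fun h0 => hv ?_
    have h1 := comps_vecAt hX hay (comps X y v)
    rw [h0] at h1
    have h2 := vecAt_comps hX hy v
    rw [← h1] at h2
    refine h2.symm.trans ?_
    simp only [comps, map_zero, vecAt]
    exact map_zero _
  smooth i j := by
    refine ((hg.smooth i j).comp (f := fun x : Coord n => a • x) (s := X.target)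
      (contDiff_const_smul a).contDiffOn hT).congr fun x hx => ?_
    rw [gram_dilatedMetric hX ha hx (hT x hx)]
    rfl

end Dilation

/-! ### Smoothness of the Gram matrix of a Riemannian metric -/

section RiemannianMetric

variable {n : ℕ} {M : Type*} [TopologicalSpace M] [ChartedSpace (Coord n) M]
  [IsManifold (𝓡 n) ∞ M] {X : OpenPartialHomeomorph M (Coord n)}

/-- This field is the image of the constant field `u` under the tangent map of the smooth map
`X.symm`. -/
theorem contMDiffOn_vecAt (hX : X ∈ IsManifold.maximalAtlas (𝓡 n) ∞ M) (u : Coord n) :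
    ContMDiffOn 𝓘(ℝ, Coord n) (𝓡 n).tangent ∞
      (fun x => (⟨X.symm x, vecAt X x u⟩ : TangentBundle (𝓡 n) M)) X.target := by
  have h1 := (contMDiffOn_symm_of_mem_maximalAtlas hX).contMDiffOn_tangentMapWithin
    (m := ∞) (by simp) X.open_target.uniqueMDiffOn
  have h2 : ContMDiffOn 𝓘(ℝ, Coord n) 𝓘(ℝ, Coord n).tangent ∞
      (fun x => (⟨x, u⟩ : TangentBundle 𝓘(ℝ, Coord n) (Coord n))) X.target := by
    intro x hx
    rw [contMDiffWithinAt_totalSpace]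
    refine ⟨contMDiffWithinAt_id, ?_⟩
    simpa using contMDiffWithinAt_const
  refine (h1.comp h2 fun x hx => hx).congr fun x hx => ?_
  simp only [Function.comp_apply, tangentMapWithin, vecAt,
    mfderivWithin_of_isOpen X.open_target hx]

theorem isRiemannianOn_metricField
    (g : ContMDiffRiemannianMetric (𝓡 n) ∞ (Coord n) (TangentSpace (𝓡 n) : M → Type _))
    (hX : X ∈ IsManifold.maximalAtlas (𝓡 n) ∞ M) : IsRiemannianOn (metricField g) X where
  symm y _ v w := g.symm y v w
  pos y _ v hv := g.pos y v hv
  smooth i j := by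
    rw [← contMDiffOn_iff_contDiffOn]
    intro x hx
    have hg := (g.contMDiff.contMDiffOn (s := Set.univ)).comp
      (contMDiffOn_symm_of_mem_maximalAtlas hX) (Set.subset_univ _) x hx
    have h := fun i => contMDiffOn_vecAt hX (EuclideanSpace.single i (1 : ℝ)) x hx
    have := ContMDiffWithinAt.clm_bundle_apply₂ (F₁ := Coord n) (F₂ := Coord n) (F₃ := ℝ)
      (E₃ := Bundle.Trivial M ℝ) hg (h i) (h j)
    rw [contMDiffWithinAt_totalSpace] at this
    exact this.2

end RiemannianMetric

/-- Removes the cast in `pushSection`. Agreement with `τ` is needed at the single point `h z`, so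
`τ` may be chosen depending on `z`. -/
theorem pushSection_eq {M : Type*} {E : M → Type*} [∀ y, AddCommGroup (E y)] {f h : M → M}
    {σ : (y : M) → E (f y)} {z : M} (hz : f (h z) = z) (τ : (y : M) → E y)
    (hσ : σ (h z) = τ (f (h z))) : pushSection f h σ z = τ z := by
  have key : ∀ w (hw : w = z), hw ▸ τ w = τ z := by rintro _ rfl; rfl
  rw [pushSection, dif_pos hz, hσ]
  exact key _ hz

/-! ### The contraction and its inverse -/

section Contraction

variable {n : ℕ} {M : Type*} [TopologicalSpace M]
  {X : OpenPartialHomeomorph M (Coord n)} {a : ℝ}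

theorem contraction_mem_source {y : M} (hay : a • X y ∈ X.target) :
    contraction X a y ∈ X.source :=
  X.map_target hay

theorem chart_contraction {y : M} (hay : a • X y ∈ X.target) :
    X (contraction X a y) = a • X y :=
  X.right_inv hay

theorem contraction_contraction_inv (ha : a ≠ 0) {z : M} (hz : z ∈ X.source)
    (haz : a⁻¹ • X z ∈ X.target) : contraction X a (contraction X a⁻¹ z) = z := by
  rw [contraction, chart_contraction haz, smul_inv_smul₀ ha, X.left_inv hz]

theorem contraction_inv_contraction (ha : a ≠ 0) {y : M} (hy : y ∈ X.source)
    (hay : a • X y ∈ X.target) : contraction X a⁻¹ (contraction X a y) = y := by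
  rw [contraction, chart_contraction hay, inv_smul_smul₀ ha, X.left_inv hy]

theorem isOpen_source_inter_contraction_preimage (X : OpenPartialHomeomorph M (Coord n)) (b : ℝ)
    {W : Set M} (hW : IsOpen W) :
    IsOpen {z | z ∈ X.source ∧ b • X z ∈ X.target ∧ contraction X b z ∈ W} := by
  have h1 : IsOpen (X.target ∩ X.symm ⁻¹' W) := X.isOpen_inter_preimage_symm hW
  have h2 : IsOpen ((fun x : Coord n => b • x) ⁻¹' (X.target ∩ X.symm ⁻¹' W)) :=
    h1.preimage (continuous_const_smul b)
  exact X.isOpen_inter_preimage h2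

theorem contMDiffOn_contraction [ChartedSpace (Coord n) M]
    (hX : X ∈ IsManifold.maximalAtlas (𝓡 n) ∞ M) (b : ℝ) :
    ContMDiffOn (𝓡 n) (𝓡 n) ∞ (contraction X b) {z | z ∈ X.source ∧ b • X z ∈ X.target} := by
  have h1 : ContMDiffOn (𝓡 n) 𝓘(ℝ, Coord n) ∞ (fun z => b • X z)
      {z | z ∈ X.source ∧ b • X z ∈ X.target} :=
    ((contDiff_const_smul b).contMDiff.comp_contMDiffOn
      (contMDiffOn_of_mem_maximalAtlas hX)).mono fun z hz => hz.1
  exact (contMDiffOn_symm_of_mem_maximalAtlas hX).comp h1 fun z hz => hz.2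

end Contraction

/-! ### Coefficients of the pulled-back and conjugated operators -/

section PullBack

variable {n : ℕ} {M : Type*} [TopologicalSpace M] [ChartedSpace (Coord n) M]
  {X : OpenPartialHomeomorph M (Coord n)} {a : ℝ}
  {E : M → Type*} [∀ y, AddCommGroup (E y)] [∀ y, Module ℝ (E y)]

theorem hasCoeffs_pullOperator (hX : X ∈ IsManifold.maximalAtlas (𝓡 n) ∞ M) (ha : a ≠ 0)
    (hT : ∀ x ∈ X.target, a • x ∈ X.target) {k m : ℕ} {s : Fin k → (y : M) → E y}
    {c : (Fin n → ℕ) → Coord n → Matrix (Fin k) (Fin k) ℝ}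
    {P : ((y : M) → E y) → (y : M) → E y} (h : HasCoeffs X s m c P) :
    HasCoeffs (V := fun y => E (contraction X a y)) X (fun j y => s j (contraction X a y)) m
      (fun γ x => a⁻¹ ^ multiLength γ • c γ (a • x))
      (pullOperator (contraction X a) (contraction X a⁻¹) P) where
  smooth γ hγ i j := by
    have h1 := (h.smooth γ hγ i j).comp (f := fun x : Coord n => a • x) (s := X.target)
      (contDiff_const_smul a).contDiffOn hT
    exact contDiffOn_const.mul h1
  apply_eq W hW hWX α hα σ hσ y hy := by
    have hyX := hWX hy
    have hay := hT _ (X.map_source hyX)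
    have hy' : contraction X a⁻¹ (contraction X a y) = y := contraction_inv_contraction ha hyX hay
    have hXy : X (contraction X a y) = a • X y := chart_contraction hay
    -- The formula for `P` is applied on the image of `W`, written as a preimage under the inverse
    -- contraction so that it is visibly open, with the coefficient functions `α j ∘ f⁻¹`.
    have key := h.apply_eq _ (isOpen_source_inter_contraction_preimage X a⁻¹ hW)
      (fun z hz => hz.1) (fun j z => α j (contraction X a⁻¹ z))
      (fun j => (hα j).comp ((contMDiffOn_contraction hX a⁻¹).mono fun z hz => ⟨hz.1, hz.2.1⟩)
        fun z hz => hz.2.2)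
      (pushSection (contraction X a) (contraction X a⁻¹) σ)
      (fun z hz => pushSection_eq (contraction_contraction_inv ha hz.1 hz.2.1)
        -- The scalars are frozen at `z`; only the frame varies with `w`.
        (fun w => ∑ j, α j (contraction X a⁻¹ z) • s j w) (hσ _ hz.2.2))
      (contraction X a y)
      ⟨contraction_mem_source hay, by rw [hXy, inv_smul_smul₀ ha]; exact X.map_source hyX,
        by rwa [hy']⟩
    refine key.trans (Finset.sum_congr rfl fun γ _ => Finset.sum_congr rfl fun i _ =>
      Finset.sum_congr rfl fun j _ => congrArg (· • s i (contraction X a y)) ?_)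
    have h1 : multiD γ (fun x => α j (contraction X a⁻¹ (X.symm x))) (a • X y) =
        a⁻¹ ^ multiLength γ * multiD γ (fun x => α j (X.symm x)) (X y) := by
      have h2 := multiD_comp_smul γ a⁻¹ (fun x => α j (X.symm x)) (a • X y)
      rw [inv_smul_smul₀ ha] at h2
      rw [← h2]
      refine (multiD_congr γ ?_).eq_of_nhds
      filter_upwards [X.open_target.mem_nhds hay] with x hx
      rw [contraction, X.right_inv hx]
    rw [hXy, h1]
    change _ = a⁻¹ ^ multiLength γ * c γ (a • X y) i j * _
    ring

/-- Since `Φ` is linear on fibres and carries the frame `s ∘ f` to `s`, it changes neither the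
component functions nor the coefficients. -/
theorem hasCoeffs_conjOperator {f : M → M} {k m : ℕ} {s : Fin k → (y : M) → E y}
    {c : (Fin n → ℕ) → Coord n → Matrix (Fin k) (Fin k) ℝ}
    {Q : ((y : M) → E (f y)) → (y : M) → E (f y)} {Φ : (y : M) → E (f y) ≃ₗ[ℝ] E y}
    (hΦ : ∀ j, ∀ y ∈ X.source, Φ y (s j (f y)) = s j y)
    (h : HasCoeffs (V := fun y => E (f y)) X (fun j y => s j (f y)) m c Q) :
    HasCoeffs X s m c (conjOperator Φ Q) where
  smooth := h.smooth
  apply_eq W hW hWX α hα σ hσ y hy := by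
    have key := h.apply_eq W hW hWX α hα (fun z => (Φ z).symm (σ z)) (fun z hz => by
      rw [LinearEquiv.symm_apply_eq, hσ z hz, map_sum]
      exact Finset.sum_congr rfl fun j _ => by rw [map_smul, hΦ j z (hWX hz)]) y hy
    rw [conjOperator, key]
    simp only [map_sum, map_smul, hΦ _ y (hWX hy)]

end PullBack

/-! ### Radial frames of the pulled-back bundle -/

section Frame

variable {n : ℕ} {M : Type*} [TopologicalSpace M] [ChartedSpace (Coord n) M]
  {X : OpenPartialHomeomorph M (Coord n)} {a : ℝ}
  {F : Type*} [NormedAddCommGroup F] [NormedSpace ℝ F]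
  {E : M → Type*} [TopologicalSpace (TotalSpace F E)] [∀ y, AddCommGroup (E y)]
  [∀ y, Module ℝ (E y)] [∀ y, TopologicalSpace (E y)] [∀ y, IsTopologicalAddGroup (E y)]
  [∀ y, ContinuousSMul ℝ (E y)] [FiberBundle F E]

/-- Pushing `σ ∘ f` forward gives back `σ` near `z`, and a covariant derivative is local on
differentiable sections. -/
theorem covariantDerivative_pushSection (nabla : CovariantDerivative (𝓡 n) F E) (ha : a ≠ 0)
    {σ : (y : M) → E y} (hσ : SmoothOn n F σ X.source) {z : M} (hz : z ∈ X.source)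
    (haz : a⁻¹ • X z ∈ X.target) :
    nabla (pushSection (contraction X a) (contraction X a⁻¹) fun y => σ (contraction X a y)) z =
      nabla σ z := by
  have h0 : ∀ᶠ w in 𝓝 z, pushSection (contraction X a) (contraction X a⁻¹)
      (fun y => σ (contraction X a y)) w = σ w := by
    filter_upwards [(isOpen_source_inter_contraction_preimage X a⁻¹ isOpen_univ).mem_nhds
      ⟨hz, haz, Set.mem_univ _⟩] with w hw
    exact pushSection_eq (contraction_contraction_inv ha hw.1 hw.2.1) σ rfl
  have h1 : MDifferentiableAt (𝓡 n) ((𝓡 n).prod 𝓘(ℝ, F))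
      (fun y => (⟨y, σ y⟩ : TotalSpace F E)) z :=
    (hσ.contMDiffAt (X.open_source.mem_nhds hz)).mdifferentiableAt (by simp)
  have h2 := h1.congr_of_eventuallyEq (f₁ := fun y => (⟨y, pushSection (contraction X a)
    (contraction X a⁻¹) (fun y => σ (contraction X a y)) y⟩ : TotalSpace F E))
    (h0.mono fun w hw => by simp only [hw])
  exact nabla.isCovariantDerivativeOn.congr_of_eventuallyEq h2 h1 univ_mem h0

theorem isRadialFrame_pullBack (hX : X ∈ IsManifold.maximalAtlas (𝓡 n) ∞ M) (ha : a ≠ 0)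
    (hT : ∀ x ∈ X.target, a • x ∈ X.target) (nabla : CovariantDerivative (𝓡 n) F E) {k : ℕ}
    {s : Fin k → (y : M) → E y} (h : IsRadialFrame (SmoothOn n F) (connection nabla) X s) :
    IsRadialFrame (V := fun y => E (contraction X a y)) (PullSmoothOn n F (contraction X a))
      (pullConnection nabla (contraction X a) (contraction X a⁻¹)) X
      (fun j y => s j (contraction X a y)) where
  smooth j := (h.smooth j).comp
    ((contMDiffOn_contraction hX a).mono fun y hy => ⟨hy, hT _ (X.map_source hy)⟩)
    fun y hy => X.map_target (hT _ (X.map_source hy))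
  linearIndependent y hy := h.linearIndependent _ (X.map_target (hT _ (X.map_source hy)))
  span_eq_top y hy := h.span_eq_top _ (X.map_target (hT _ (X.map_source hy)))
  parallel j x t ht := by
    have hy : ray X x t ∈ X.source := X.map_target ht
    have hXy : X (ray X x t) = t • x := X.right_inv ht
    have hay : a • X (ray X x t) ∈ X.target := hT _ (X.map_source hy)
    have hat : t ∈ rayTimes X (a • x) := by
      rw [hXy] at hay
      rwa [smul_comm] at hay
    have key := h.parallel j (a • x) t hat
    rw [connection, velocity_ray hX hat, vecAt_smul] at key
    rw [pullConnection, covariantDerivative_pushSection nabla ha (h.smooth j)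
      (contraction_mem_source hay)
      (by rw [chart_contraction hay, inv_smul_smul₀ ha]; exact X.map_source hy),
      mfderiv_contraction hX hy hay, comps_velocity_ray hX ht]
    -- The differential of the contraction sends the velocity of the ray in direction `x` to that of
    -- the ray in direction `a • x`, along which `s j` is parallel; only the two expressions for the
    -- base point remain to be identified.
    have h1 : ∀ w, w = t • (a • x) →
        nabla (s j) (X.symm w) (a • vecAt X w x) = 0 := by
      rintro _ rfl; exact key
    exact h1 _ (by rw [hXy, smul_comm])

end Frame

end GeomOp

/-! ### Assembly -/

theorem proposition4p11 {n : ℕ} {M : Type*} [TopologicalSpace M]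
    [ChartedSpace (Coord n) M] [IsManifold (𝓡 n) ∞ M]
    {F : Type*} [NormedAddCommGroup F] [NormedSpace ℝ F] [FiniteDimensional ℝ F]
    {E : M → Type*} [TopologicalSpace (TotalSpace F E)] [∀ y, AddCommGroup (E y)]
    [∀ y, Module ℝ (E y)] [∀ y, TopologicalSpace (E y)] [∀ y, IsTopologicalAddGroup (E y)]
    [∀ y, ContinuousSMul ℝ (E y)] [FiberBundle F E] [VectorBundle ℝ F E]
    [ContMDiffVectorBundle ∞ F E (𝓡 n)]
    (nabla : CovariantDerivative (𝓡 n) F E)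
    [CovariantDerivative.ContMDiffCovariantDerivative nabla ∞]
    (g : ContMDiffRiemannianMetric (𝓡 n) ∞ (Coord n) (TangentSpace (𝓡 n) : M → Type _))
    (p : M) (e : Fin n → TangentSpace (𝓡 n) p) (r : ℝ)
    (X : OpenPartialHomeomorph M (Coord n))
    (m : ℕ) (P : ((y : M) → E y) → (y : M) → E y)
    (hP : IsGeometric (Module.finrank ℝ F) (metricField g) p e r X
      (SmoothOn n F) (connection nabla) m P)
    (lam : ℝ) (hlam_pos : 0 < lam) (hlam_lt : lam < 1) :
    -- the dilated metric is a Riemannian metric on the geodesic neighbourhood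
    IsRiemannianOn (dilatedMetric (metricField g) X lam) X ∧
    -- the pulled-back operator, on sections of the pulled-back bundle with the pulled-back
    -- connection, is geometric of order `m` for the dilated metric
    IsGeometric (V := fun y => E (contraction X lam y)) (Module.finrank ℝ F)
      (dilatedMetric (metricField g) X lam) p e r X
      (PullSmoothOn n F (contraction X lam))
      (pullConnection nabla (contraction X lam) (contraction X lam⁻¹)) m
      (pullOperator (contraction X lam) (contraction X lam⁻¹) P) ∧
    -- so is the operator on sections of `E` obtained by identifying the pulled-back bundle with `E`
    -- through parallel transport along the radial geodesics
    (∀ Φ : (y : M) → E (contraction X lam y) ≃ₗ[ℝ] E y,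
      IsRadialTransport nabla X (contraction X lam) Φ →
      IsGeometric (Module.finrank ℝ F)
        (dilatedMetric (metricField g) X lam) p e r X
        (SmoothOn n F) (connection nabla) m
        (conjOperator Φ (pullOperator (contraction X lam)
          (contraction X lam⁻¹) P))) ∧
    -- the coefficients have the same Gilkey orders, and the order is the same
    (∀ (ε : Fin n → (y : M) → TangentSpace (𝓡 n) y)
      (s : Fin (Module.finrank ℝ F) → (y : M) → E y)
      (c : (Fin n → ℕ) → Coord n →
        Matrix (Fin (Module.finrank ℝ F)) (Fin (Module.finrank ℝ F)) ℝ),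
      IsTangentFrame (metricField g) p e X ε →
      IsRadialFrame (SmoothOn n F) (connection nabla) X s →
      HasCoeffs X s m c P →
      ∃ (ε' : Fin n → (y : M) → TangentSpace (𝓡 n) y)
        (c' : (Fin n → ℕ) → Coord n →
          Matrix (Fin (Module.finrank ℝ F)) (Fin (Module.finrank ℝ F)) ℝ),
        IsTangentFrame (dilatedMetric (metricField g) X lam) p e X ε' ∧
        IsRadialFrame (V := fun y => E (contraction X lam y))
          (PullSmoothOn n F (contraction X lam))
          (pullConnection nabla (contraction X lam) (contraction X lam⁻¹)) X
          (fun j y => s j (contraction X lam y)) ∧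
        HasCoeffs (V := fun y => E (contraction X lam y)) X
          (fun j y => s j (contraction X lam y)) m c'
          (pullOperator (contraction X lam) (contraction X lam⁻¹) P) ∧
        ∀ γ ∈ multiIndices n m,
          (∀ x ∈ X.target, c' γ x = 0 ↔ c γ (lam • x) = 0) ∧
          ∀ d : ℕ, IsGeometricPolynomial X ε' X.target (c' γ) d ↔
            IsGeometricPolynomial X ε ((fun x => lam • x) '' X.target) (c γ) d) := by
  obtain ⟨hN, ε₀, s₀, c₀, hε₀, hs₀, hc₀, hq₀⟩ := hP
  have hX := hN.mem_atlas
  have ha : lam ≠ 0 := hlam_pos.ne'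
  have hT : ∀ x ∈ X.target, lam • x ∈ X.target := fun x hx =>
    smul_mem_target hN.target_eq (by rw [abs_of_pos hlam_pos]; exact hlam_lt.le) hx
  have hN' := isNormalChart_dilatedMetric hN ha hT
  have hε₀' := isTangentFrame_dilatedFrame hX ha hT hN.base_mem hN.base_eq hε₀
  have hc₀' := hasCoeffs_pullOperator hX ha hT hc₀
  have hq₀' : ∀ γ ∈ multiIndices n m, IsGeometricPolynomial X (dilatedFrame X lam ε₀) X.target
      (fun x => lam⁻¹ ^ multiLength γ • c₀ γ (lam • x)) (m - multiLength γ) := by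
    intro γ hγ
    rw [isGeometricPolynomial_dilatedFrame_iff hX ha (pow_ne_zero _ (inv_ne_zero ha))]
    intro i j
    obtain ⟨Q, hQ, h⟩ := hq₀ γ hγ i j
    refine ⟨Q, hQ, ?_⟩
    rintro _ ⟨x, hx, rfl⟩
    -- The contracted ball lies in the original one, so the polynomial representing `c₀ γ` there
    -- still represents it.
    exact h _ (hT x hx)
  refine ⟨isRiemannianOn_dilatedMetric hX ha hT (isRiemannianOn_metricField g hX),
    ⟨hN', _, _, _, hε₀', isRadialFrame_pullBack hX ha hT nabla hs₀, hc₀', hq₀'⟩,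
    fun Φ hΦ => ⟨hN', _, _, _, hε₀', hs₀,
      hasCoeffs_conjOperator (fun j => hΦ _ (hs₀.smooth j) (hs₀.parallel j)) hc₀', hq₀'⟩,
    fun ε s c hε hs hc => ⟨_, _,
      isTangentFrame_dilatedFrame hX ha hT hN.base_mem hN.base_eq hε,
      isRadialFrame_pullBack hX ha hT nabla hs, hasCoeffs_pullOperator hX ha hT hc,
      fun γ _ => ⟨fun x _ => ?_, fun d => isGeometricPolynomial_dilatedFrame_iff hX ha
        (pow_ne_zero _ (inv_ne_zero ha)) ε (c γ) d⟩⟩⟩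
  exact smul_eq_zero_iff_right (pow_ne_zero _ (inv_ne_zero ha))
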